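/- All semigroups, groups and sets of states are finite. A transformation semigroup (ts) $(Q,T)$ is a subsemigroup $T$ of the semigroup of partial transformations of $Q$, acting on the right. A GM transformation semigroup $(G\times B,S)$ is given as follows. $S$ is a semigroup with a regular $0$-minimal ideal $I(S)$ (minimal ideal, if $S$ has no zero) isomorphic to a Rees matrix semigroup $M^0(G,A,B,C)$ over a nontrivial group $G$, such that $S$ acts faithfully by the right (left) Schützenberger representation on the $\mathcal R$-classes ($\mathcal L$-classes) of $I(S)\setminus\{0\}$; a fixed $\mathcal R$-class is identified with $G\times B$, and $S$ acts on it by right multiplication ($(g,b)s$ is undefined when the product leaves the class). $(B,\mathrm{RLM}(S))$ is the faithful image of the induced action of $S$ on $B$. Let $X$ be an alphabet with maps $x\mapsto s_x\in S$ and $x\mapsto t_x\in T$ whose images generate $S$ and $T$. A (complete) flow $\Phi:Q\to Rh_B(G)$ assigns to each $q\in Q$ a pair $q\Phi=(Y_q,\Pi_q)$, where $Y_q\subseteq G\times B$ and $\Pi_q$ is a partition of $Y_q$, such that: (i) $(Y_q,\Pi_q)$ is invariant under the left action $k(g,b)=(kg,b)$ of $G$, and no $\Pi_q$-class contains $(g,b),(h,b)$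 with $g\ne h$; (ii) the sets $Y_q$ cover $G\times B$; (iii) if $qt_x=q'$ is defined, then $Y_qs_x\subseteq Y_{q'}$, and for $y,y'\in Y_q$ with $ys_x,y's_x$ defined, $y\mathrel{\Pi_q}y'$ iff $ys_x\mathrel{\Pi_{q'}}y's_x$; (iv) if $qt_x$ is undefined, then $ys_x$ is undefined for all $y\in Y_q$. A division $(P,S)\prec(R,W)$ of ts is a surjective partial function $\varphi:R\to P$ such that every $s\in S$ is covered by some $w\in W$, meaning that whenever $r\varphi$ and $(r\varphi)s$ are defined, $rw$ and $(rw)\varphi$ are defined and $(rw)\varphi=(r\varphi)s$. The covering is exact if moreover, for $r$ in the domain of $\varphi$, $rw$ is defined only if $(r\varphi)s$ is; a division is exact if every $s\in S$ is covered exactly by some $w\in W$ (that is, $(P,S)$ is an image of a sub-ts of $(R,W)$). A division of $(G\times B,S)$ in $(G\wr \mathrm{Sym}(B)\wr (Q,T))\times (B,\mathrm{RLM}(S))$ respects $X$ if for every $x\in X$ the element $s_x$ is covered (exactly, if the division is exact) by some $((\rho_x,t_x),\bar s_x)$, where $\rho_x$ is a function from the domain of $t_x$ to $G\wr \mathrm{Sym}(B)$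 and $\bar s_x$ is the image of $s_x$ in $\mathrm{RLM}(S)$. **Theorem.** Let $(G\times B,S)$ be a GM transformation semigroup and $(Q,T)$ a transformation semigroup, both generated by $X$. The following are equivalent: 1. there is a flow $\Phi:Q\to Rh_B(G)$; 2. $(G\times B,S)\prec (G\wr \mathrm{Sym}(B)\wr T)\times \mathrm{RLM}(S)$ by a division that respects $X$; 3. $(G\times B,S)\prec (G\wr \mathrm{Sym}(B)\wr T)\times \mathrm{RLM}(S)$ by an exact division that respects $X$. -/

import Mathlib

namespace FlowTheory

/-! ### Partial transformations and transformation semigroups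

A transformation semigroup (ts) `(Q, S)` is a subsemigroup `S : Subsemigroup (PT Q)` of the
semigroup of all partial transformations of `Q`, which act on the right. -/

/-- Partial transformations of `Q`; `s q = none` means that `q s` is undefined. -/
abbrev PT (Q : Type*) : Type _ := Q → Option Q

/-- Composition from left to right: `q (s * t) = (q s) t`. -/
instance PT.instSemigroup (Q : Type*) : Semigroup (PT Q) where
  mul s t := fun q => (s q).bind t
  mul_assoc s t u := by
    funext q
    change ((s q).bind t).bind u = (s q).bind (fun r => (t r).bind u)
    cases s q <;> rfl

theorem PT.mul_apply {Q : Type*} (s t : PT Q) (q : Q) : (s * t) q = (s q).bind t := rfl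

/-- The partial transformation `(p, q) ↦ (p (q f), q s)` of `P × Q`, defined when `q s` is defined
and `p` lies in the domain of `q f`. Only the values of `f` on the domain of `s` matter. -/
def wreathMap {P Q : Type*} (f : Q → PT P) (s : PT Q) : PT (P × Q) :=
  fun z => (s z.2).bind fun q' => (f z.2 z.1).map fun p' => (p', q')

/-- The wreath product `(P, K) ≀ (Q, T)`: all `(f, s)` with `s ∈ T` and `f : Dom s → K`. -/
def wreath {P Q : Type*} (K : Subsemigroup (PT P)) (T : Subsemigroup (PT Q)) :
    Subsemigroup (PT (P × Q)) where
  carrier := {w | ∃ s ∈ T, ∃ f : Q → PT P, (∀ q q', s q = some q' → f q ∈ K) ∧ w = wreathMap f s}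
  mul_mem' := by
    rintro _ _ ⟨s, hs, f, hf, rfl⟩ ⟨t, ht, g, hg, rfl⟩
    refine ⟨s * t, T.mul_mem hs ht,
      fun q => (s q).elim (f q) (fun q' => f q * g q'), ?_, ?_⟩
    · intro q q'' h
      rw [PT.mul_apply] at h
      cases hq : s q with
      | none => simp [hq] at h
      | some q' =>
        simp only [hq, Option.bind_some] at h
        simpa [hq] using K.mul_mem (hf q q' hq) (hg q' q'' h)
    · funext ⟨p, q⟩
      rw [PT.mul_apply]
      simp only [wreathMap, PT.mul_apply]
      cases hq : s q with
      | none => rfl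
      | some q' =>
        simp only [Option.bind_some, Option.elim_some, PT.mul_apply]
        cases hp : f q p with
        | none => cases t q' <;> simp
        | some p' => simp [wreathMap]

/-- The partial transformation `(p, q) ↦ (p s, q t)`, defined when both entries are. -/
def prodMap {P Q : Type*} (s : PT P) (t : PT Q) : PT (P × Q) :=
  fun z => (s z.1).bind fun p' => (t z.2).map fun q' => (p', q')

/-- The direct product `(P, S) × (Q, T)` of transformation semigroups. -/
def directProd {P Q : Type*} (S : Subsemigroup (PT P)) (T : Subsemigroup (PT Q)) :
    Subsemigroup (PT (P × Q)) where
  carrier := {w | ∃ s ∈ S, ∃ t ∈ T, w = prodMap s t}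
  mul_mem' := by
    rintro _ _ ⟨s, hs, t, ht, rfl⟩ ⟨s', hs', t', ht', rfl⟩
    refine ⟨s * s', S.mul_mem hs hs', t * t', T.mul_mem ht ht', ?_⟩
    funext ⟨p, q⟩
    simp only [PT.mul_apply, prodMap]
    cases s p with
    | none => rfl
    | some p' =>
      cases t q with
      | none => simp
      | some q' => rfl

/-- The transformation group `(G, G)`: `G` acting on itself by right multiplication. -/
def regularTS (G : Type*) [Group G] : Subsemigroup (PT G) where
  carrier := {w | ∃ g : G, w = fun h => some (h * g)}
  mul_mem' := by
    rintro _ _ ⟨g, rfl⟩ ⟨g', rfl⟩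
    exact ⟨g * g', funext fun h => by simp [PT.mul_apply, mul_assoc]⟩

/-- The transformation group `(B, Sym(B))`. -/
def symTS (B : Type*) : Subsemigroup (PT B) where
  carrier := {w | ∃ e : Equiv.Perm B, w = fun b => some (e b)}
  mul_mem' := by
    rintro _ _ ⟨e, rfl⟩ ⟨e', rfl⟩
    exact ⟨e.trans e', funext fun b => by simp [PT.mul_apply]⟩

/-- The transformation group `(G × B, G ≀ Sym(B))`. -/
def gWrSym (G B : Type*) [Group G] : Subsemigroup (PT (G × B)) :=
  wreath (regularTS G) (symTS B)

/-! ### Group mapping transformation semigroups -/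

/-- `z` is a zero of the semigroup `S`. -/
def IsZeroElement {S : Type*} [Mul S] (z : S) : Prop := ∀ s : S, z * s = z ∧ s * z = z

/-- `(G × B, S)` is a `GM` transformation semigroup, with its Rees coordinates.

The elements `ι (a, g, b)` (together with the zero of `S`, if there is one) form a regular
0-minimal ideal `I(S)`, identified with the Rees matrix semigroup `M⁰(G, A, B, C)`; the `R`-class
`{ι (a₀, g, b)}` is identified with `G × B`, and `S` acts on `G × B` by the right Schützenberger
representation on this class. That representation is faithful because the elements of `S` are
partial transformations of `G × B`; the left Schützenberger representation is faithful by
`left_faithful`. The structure group `G` is nontrivial. (Faithfulness makes `I(S)` the only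
0-minimal ideal. Products outside the range of `ι` are the zero, so two elements of `S` act in the
same way on the `L`-class indexed by `b` iff they have the same products with `ι (a, g, b)`.) -/
structure GroupMappingTS {G B : Type*} [Group G] (S : Subsemigroup (PT (G × B)))
    (A : Type*) where
  nontrivial : Nontrivial G
  /-- the sandwich matrix -/
  C : B → A → WithZero G
  ι : A × G × B → S
  /-- the index of the distinguished `R`-class -/
  a₀ : A
  ι_injective : Function.Injective ι
  row_ne_zero : ∀ b, ∃ a, C b a ≠ 0
  col_ne_zero : ∀ a, ∃ b, C b a ≠ 0
  ι_mul : ∀ a g b a' g' b' (c : G), C b a' = (c : WithZero G) →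
    ι (a, g, b) * ι (a', g', b') = ι (a, g * c * g', b')
  ι_mul_zero : ∀ a g b a' g' b', C b a' = 0 → IsZeroElement (ι (a, g, b) * ι (a', g', b'))
  ideal_right : ∀ i (s : S), ι i * s ∈ Set.range ι ∨ IsZeroElement (ι i * s)
  ideal_left : ∀ i (s : S), s * ι i ∈ Set.range ι ∨ IsZeroElement (s * ι i)
  /-- the given action on `G × B` is right multiplication on the distinguished `R`-class -/
  action : ∀ (s : S) g b g' b',
    (s : PT (G × B)) (g, b) = some (g', b') ↔ ι (a₀, g, b) * s = ι (a₀, g', b')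
  left_faithful : ∀ (b : B) (s t : S), (∀ a g, s * ι (a, g, b) = t * ι (a, g, b)) → s = t

/-- The partial transformation of `B` induced by a partial transformation of `G × B` that
commutes with the left action of `G` (the choice of `1 : G` is then immaterial). -/
def rlmMap {G B : Type*} [Group G] (s : PT (G × B)) : PT B :=
  fun b => (s (1, b)).map Prod.snd

namespace GroupMappingTS

variable {G B A : Type*} [Group G] {S : Subsemigroup (PT (G × B))}

/-- The action of `S` on `G × B` commutes with the left action of `G`. -/
theorem equivariant (gm : GroupMappingTS S A) (s : S) (k g g' : G) (b b' : B)
    (h : (s : PT (G × B)) (g, b) = some (g', b')) :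
    (s : PT (G × B)) (k * g, b) = some (k * g', b') := by
  rw [gm.action] at h ⊢
  obtain ⟨b₁, hb₁⟩ := gm.col_ne_zero gm.a₀
  obtain ⟨c, hc⟩ := WithZero.ne_zero_iff_exists.1 hb₁
  have key : ∀ (u : G) (v : B),
      gm.ι (gm.a₀, k * c⁻¹, b₁) * gm.ι (gm.a₀, u, v) = gm.ι (gm.a₀, k * u, v) := by
    intro u v
    rw [gm.ι_mul _ _ _ _ _ _ c hc.symm]
    simp
  rw [← key g b, mul_assoc, h, key]

theorem rlmMap_mul (gm : GroupMappingTS S A) (s t : S) :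
    rlmMap ((s : PT (G × B)) * (t : PT (G × B))) =
      rlmMap (s : PT (G × B)) * rlmMap (t : PT (G × B)) := by
  funext b
  rw [PT.mul_apply]
  simp only [rlmMap, PT.mul_apply]
  cases hs : (s : PT (G × B)) (1, b) with
  | none => rfl
  | some z =>
    obtain ⟨g, b'⟩ := z
    simp only [Option.bind_some, Option.map_some]
    cases ht : (t : PT (G × B)) (g, b') with
    | some w =>
      obtain ⟨g', b''⟩ := w
      have := gm.equivariant t g⁻¹ g g' b' b'' ht
      rw [inv_mul_cancel] at this
      simp [rlmMap, this]
    | none =>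
      cases ht' : (t : PT (G × B)) (1, b') with
      | none => simp [rlmMap, ht']
      | some w =>
        obtain ⟨g', b''⟩ := w
        have := gm.equivariant t g 1 g' b' b'' ht'
        rw [mul_one, ht] at this
        cases this

/-- `(B, RLM(S))`, the faithful image of the action of `S` on `B`. -/
def RLM (gm : GroupMappingTS S A) : Subsemigroup (PT B) where
  carrier := {r | ∃ s ∈ S, r = rlmMap s}
  mul_mem' := by
    rintro _ _ ⟨s, hs, rfl⟩ ⟨t, ht, rfl⟩
    exact ⟨s * t, S.mul_mem hs ht, (gm.rlmMap_mul ⟨s, hs⟩ ⟨t, ht⟩).symm⟩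

end GroupMappingTS

/-! ### Set-partitions and flows -/

/-- An element `(Y, Π)` of the set-partition lattice `SP(Z)`: a subset `Y = carrier` of `Z` and a
partition of `Y`, given by its equivalence relation `rel` on `Y`. -/
structure SetPartition (Z : Type*) where
  carrier : Set Z
  rel : Z → Z → Prop
  mem_of_rel : ∀ y z, rel y z → y ∈ carrier ∧ z ∈ carrier
  refl : ∀ y ∈ carrier, rel y y
  symm : ∀ y z, rel y z → rel z y
  trans : ∀ x y z, rel x y → rel y z → rel x z

/-- The bottom `(∅, ∅)` of the set-partition lattice. -/
def SetPartition.empty (Z : Type*) : SetPartition Z where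
  carrier := ∅
  rel _ _ := False
  mem_of_rel _ _ h := h.elim
  refl _ h := h.elim
  symm _ _ h := h
  trans _ _ _ h _ := h

/-- Every partition class meets each fibre `G × {b}` in at most one point. -/
def SetPartition.IsCrossSection {G B : Type*} (p : SetPartition (G × B)) : Prop :=
  ∀ g h b, p.rel (g, b) (h, b) → g = h

/-- `(Y, Π)` is invariant under the left action `k (g, b) = (k g, b)` of `G`. -/
def SetPartition.IsInvariant {G B : Type*} [Group G] (p : SetPartition (G × B)) : Prop :=
  (∀ k g b, (k * g, b) ∈ p.carrier ↔ (g, b) ∈ p.carrier) ∧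
  ∀ k g b g' b', p.rel (k * g, b) (k * g', b') ↔ p.rel (g, b) (g', b')

/-- A flow to `SP(G × B)` on the deterministic automaton with state set `Q`, alphabet `X` and
transitions `δ`; the letter `x` acts on `G × B` as `σ x`. -/
structure IsFlow {G B Q X : Type*} (σ : X → PT (G × B)) (δ : X → PT Q)
    (f : Q → SetPartition (G × B)) : Prop where
  covers : ∀ z : G × B, ∃ q, z ∈ (f q).carrier
  maps : ∀ q x q', δ x q = some q' →
    ∀ y ∈ (f q).carrier, ∀ z, σ x y = some z → z ∈ (f q').carrier
  injective : ∀ q x q', δ x q = some q' →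
    ∀ y ∈ (f q).carrier, ∀ y' ∈ (f q).carrier, ∀ z z', σ x y = some z → σ x y' = some z' →
      ((f q).rel y y' ↔ (f q').rel z z')
  crossSection : ∀ q, (f q).IsCrossSection

/-- The completion of an automaton: a sink `none` is added, and undefined transitions lead to it. -/
def completion {Q X : Type*} (δ : X → PT Q) : X → PT (Option Q) :=
  fun x o => some (o.bind (δ x))

/-- A complete flow: it stays a flow on the completion when the sink is sent to `(∅, ∅)`. -/
structure IsCompleteFlow {G B Q X : Type*} (σ : X → PT (G × B)) (δ : X → PT Q)
    (f : Q → SetPartition (G × B)) : Prop where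
  isFlow : IsFlow σ δ f
  isFlow_completion :
    IsFlow σ (completion δ) (fun o : Option Q => o.elim (SetPartition.empty (G × B)) f)

/-- A (complete) flow to the Rhodes lattice `Rh_B(G)`: a complete flow to `SP(G × B)` all of whose
values are invariant cross-sections, i.e. lie in `CS(G × B)`. -/
structure IsRhodesFlow {G B Q X : Type*} [Group G] (σ : X → PT (G × B)) (δ : X → PT Q)
    (f : Q → SetPartition (G × B)) : Prop where
  isCompleteFlow : IsCompleteFlow σ δ f
  invariant : ∀ q, (f q).IsInvariant

/-! ### Division of transformation semigroups -/

/-- `w` covers `s` with respect to the partial function `φ : R → P`: for every state `r`, if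
`(r φ) s` is defined then so is `(r w) φ`, and they are equal. -/
def Covers {P R : Type*} (φ : R → Option P) (w : PT R) (s : PT P) : Prop :=
  ∀ r p p', φ r = some p → s p = some p' → ∃ r', w r = some r' ∧ φ r' = some p'

/-- `w` covers `s` exactly: for every `r` in the domain of `φ`, `r w` is defined iff `(r φ) s` is,
and then `(r w) φ` is defined and equal to `(r φ) s`. -/
def CoversExactly {P R : Type*} (φ : R → Option P) (w : PT R) (s : PT P) : Prop :=
  ∀ r p, φ r = some p → (w r).map φ = (s p).map some

/-- `φ` is a division `(P, S) ≺ (R, W)`: a surjective partial function `R → P` such that every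
`s ∈ S` is covered by some `w ∈ W`. -/
structure IsDivision {P R : Type*} (φ : R → Option P) (S : Subsemigroup (PT P))
    (W : Subsemigroup (PT R)) : Prop where
  surjective : ∀ p, ∃ r, φ r = some p
  covers : ∀ s ∈ S, ∃ w ∈ W, Covers φ w s

/-- `φ` is an exact division: it presents `(P, S)` as the image of a sub-ts of `(R, W)` (with
states the domain of `φ` and semigroup the `w ∈ W` that cover some `s ∈ S` exactly). -/
structure IsExactDivision {P R : Type*} (φ : R → Option P) (S : Subsemigroup (PT P))
    (W : Subsemigroup (PT R)) : Prop where
  surjective : ∀ p, ∃ r, φ r = some p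
  covers : ∀ s ∈ S, ∃ w ∈ W, CoversExactly φ w s

/-- The elements of `((P, K) ≀ (Q, T)) × (B, R)` that lie over `t ∈ T` and `r ∈ R`. -/
def liftsOver {P Q B : Type*} (K : Subsemigroup (PT P)) (t : PT Q) (r : PT B) :
    Set (PT ((P × Q) × B)) :=
  {w | ∃ ρ : Q → PT P, (∀ q q', t q = some q' → ρ q ∈ K) ∧ w = prodMap (wreathMap ρ t) r}

end FlowTheory

/-!
A flow and a division carry the same information: how the states `(g, b)` lying over a state `q`
are labelled by points of `G × B`.

*From a flow to a division* (`exists_exact_covers_of_isRhodesFlow`). The group `G` permutes the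
classes of `Π_q` freely, because these are cross-sections. So there is a `G`-equivariant choice
`α_q y` of a representative of the class of `y` (`SetPartition.exists_equivariant_transversal`), and
`φ ((p, q), b)` is the unique `(g, b) ∈ Y_q` with `α_q (g, b) = p`. By the injectivity of the flow, a
letter induces a partial injective equivariant map between the representatives over `q` and over
`q'`; it extends to an element of `G ≀ Sym(B)` (`exists_mem_gWrSym_of_equivariant`), which is the
value of `ρ_x` at `q`.

*From a division to a flow* (`exists_isRhodesFlow_of_covers`). The label set of a pair `(q, y)` is
`fiber φ (q, y) = {p | φ ((p, q), b) = y}`, where `b` is the second coordinate of `y`. Some label set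
is nonempty, since an element of the 0-minimal ideal collapses its domain in `B` to one point. A
letter acts on labels over `q` by an injective map, hence label sets do not shrink along the graph of
the pairs `(q, y)`. In a terminal strong component `M` of this graph the letters therefore induce
*bijections* between label sets. Two states over `q` are declared equivalent when all their left
translates by `G` have the same label sets within `M` (`fiberPartition`); taking all translates makes
the partition invariant. Distinct `(g, b)` and `(h, b)` have disjoint nonempty label sets because
`φ` is a function, so the classes are cross-sections. Left translates of `M` are terminal strong
components too, so they are equal to `M` or disjoint from it, which is why the comparison of label
sets is not affected by the action of a letter.
-/

namespace FlowTheory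

variable {G B Q X A : Type*} [Group G]

/-! ### The left action of `G` on `G × B` -/

/-- The left action `k (g, b) = (k g, b)` of `G` on `G × B`. -/
def lmul (k : G) (y : G × B) : G × B := (k * y.1, y.2)

@[simp] theorem lmul_mk (k g : G) (b : B) : lmul k (g, b) = (k * g, b) := rfl

@[simp] theorem lmul_snd (k : G) (y : G × B) : (lmul k y).2 = y.2 := rfl

@[simp] theorem one_lmul (y : G × B) : lmul 1 y = y := by simp [lmul]

@[simp] theorem lmul_lmul (k l : G) (y : G × B) : lmul k (lmul l y) = lmul (k * l) y := by
  simp [lmul, mul_assoc]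

theorem SetPartition.IsInvariant.mem_iff {p : SetPartition (G × B)} (hp : p.IsInvariant) (k : G)
    (y : G × B) : lmul k y ∈ p.carrier ↔ y ∈ p.carrier :=
  hp.1 k y.1 y.2

theorem SetPartition.IsInvariant.rel_iff {p : SetPartition (G × B)} (hp : p.IsInvariant) (k : G)
    (y y' : G × B) : p.rel (lmul k y) (lmul k y') ↔ p.rel y y' :=
  hp.2 k y.1 y.2 y'.1 y'.2

/-! ### The action of a `GM` semigroup on `G × B` and on `B` -/

namespace GroupMappingTS

variable {S : Subsemigroup (PT (G × B))}

theorem apply_lmul (gm : GroupMappingTS S A) {s : PT (G × B)} (hs : s ∈ S) (k : G) {y z : G × B}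
    (h : s y = some z) : s (lmul k y) = some (lmul k z) :=
  gm.equivariant ⟨s, hs⟩ k _ _ _ _ h

theorem rlmMap_apply (gm : GroupMappingTS S A) {s : PT (G × B)} (hs : s ∈ S) {y z : G × B}
    (h : s y = some z) : rlmMap s y.2 = some z.2 := by
  have := gm.apply_lmul hs y.1⁻¹ h
  simp only [lmul, inv_mul_cancel] at this
  simp [rlmMap, this]

theorem exists_apply_of_rlmMap (gm : GroupMappingTS S A) {s : PT (G × B)} (hs : s ∈ S) {y : G × B}
    {b : B} (h : rlmMap s y.2 = some b) : ∃ z, s y = some z := by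
  obtain ⟨z, hz, -⟩ := Option.map_eq_some_iff.1 h
  have := gm.apply_lmul hs y.1 hz
  exact ⟨_, by simpa using this⟩

/-- `S` is transitive on `G × B`. -/
theorem exists_apply_eq (gm : GroupMappingTS S A) (y z : G × B) : ∃ s ∈ S, s y = some z := by
  obtain ⟨g, b⟩ := y
  obtain ⟨h, b'⟩ := z
  obtain ⟨a, ha⟩ := gm.row_ne_zero b
  obtain ⟨c, hc⟩ := WithZero.ne_zero_iff_exists.1 ha
  refine ⟨gm.ι (a, c⁻¹ * g⁻¹ * h, b'), Subtype.coe_prop _, ?_⟩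
  rw [gm.action, gm.ι_mul _ _ _ _ _ _ c hc.symm]
  simp [mul_assoc]

/-- No nonzero element of the Rees matrix semigroup is a zero, as `G` is nontrivial. -/
theorem not_isZeroElement (gm : GroupMappingTS S A) (i : A × G × B) :
    ¬ IsZeroElement (gm.ι i) := by
  intro hz
  obtain ⟨a, g, b⟩ := i
  obtain ⟨a', ha'⟩ := gm.row_ne_zero b
  obtain ⟨c, hc⟩ := WithZero.ne_zero_iff_exists.1 ha'
  have := gm.nontrivial
  obtain ⟨k, hk⟩ := exists_ne (1 : G)
  have h := (hz (gm.ι (a', k, b))).1.trans (hz (gm.ι (a', 1, b))).1.symm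
  rw [gm.ι_mul _ _ _ _ _ _ c hc.symm, gm.ι_mul _ _ _ _ _ _ c hc.symm] at h
  exact hk (by simpa using gm.ι_injective h)

/-- Every state lies in the domain of an element of the 0-minimal ideal, and such an element is
constant on its domain in `B`. -/
theorem exists_collapse (gm : GroupMappingTS S A) (y : G × B) :
    ∃ s ∈ S, ∃ z, s y = some z ∧ ∀ b b', rlmMap s b = some b' → b' = z.2 := by
  obtain ⟨g, b₀⟩ := y
  obtain ⟨a, ha⟩ := gm.row_ne_zero b₀
  obtain ⟨c, hc⟩ := WithZero.ne_zero_iff_exists.1 ha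
  refine ⟨gm.ι (a, 1, b₀), Subtype.coe_prop _, (g * c, b₀), ?_, ?_⟩
  · rw [gm.action, gm.ι_mul _ _ _ _ _ _ c hc.symm, mul_one]
  · intro b b' h
    obtain ⟨⟨h', b''⟩, hz, rfl⟩ := Option.map_eq_some_iff.1 h
    rw [gm.action] at hz
    by_cases h0 : gm.C b a = 0
    · have := gm.ι_mul_zero gm.a₀ 1 b a 1 b₀ h0
      rw [hz] at this
      exact absurd this (gm.not_isZeroElement _)
    · obtain ⟨d, hd⟩ := WithZero.ne_zero_iff_exists.1 h0
      rw [gm.ι_mul _ _ _ _ _ _ d hd.symm] at hz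
      have := gm.ι_injective hz
      simp_all

end GroupMappingTS

/-! ### Elements of `G ≀ Sym(B)` -/

/-- The elements of `G ≀ Sym(B)` are permutations of `G × B`. -/
theorem exists_injective_of_mem_gWrSym {w : PT (G × B)} (hw : w ∈ gWrSym G B) :
    ∃ f : G × B → G × B, Function.Injective f ∧ ∀ p, w p = some (f p) := by
  obtain ⟨_, ⟨e, rfl⟩, f, hf, rfl⟩ := hw
  choose c hc using fun b => hf b (e b) rfl
  refine ⟨fun p => (p.1 * c p.2, e p.2), ?_, ?_⟩
  · rintro ⟨g, b⟩ ⟨h, b'⟩ hp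
    obtain ⟨h₁, h₂⟩ := Prod.mk.inj hp
    obtain rfl := e.injective h₂
    simpa using h₁
  · intro p
    simp [wreathMap, hc]

/-- A partial injective map of `G × B` (given by its graph) that commutes with the left action of
`G` extends to an element of `G ≀ Sym(B)`. -/
theorem exists_mem_gWrSym_of_equivariant [Finite B] (R : G × B → G × B → Prop)
    (equiv : ∀ k u v, R u v → R (lmul k u) (lmul k v))
    (func : ∀ u v v', R u v → R u v' → v = v') (inj : ∀ u u' v, R u v → R u' v → u = u') :
    ∃ w ∈ gWrSym G B, ∀ u v, R u v → w u = some v := by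
  classical
  have key : ∀ b : {b : B // ∃ v, R (1, b) v}, ∃ v, R (1, b) v := fun b => b.2
  choose F hF using key
  have hinj : Function.Injective fun b => (F b).2 := by
    intro b b' h
    have h₁ := equiv ((F b).1 * (F b').1⁻¹) _ _ (hF b')
    have h₂ : lmul ((F b).1 * (F b').1⁻¹) (F b') = F b := by
      ext
      · simp [lmul]
      · exact h.symm
    rw [h₂] at h₁
    exact Subtype.ext (Prod.mk.inj (inj _ _ _ (hF b) h₁)).2
  have := Fintype.ofFinite B
  let e := (Equiv.ofInjective _ hinj).extendSubtype
  have he : ∀ b (hb : ∃ v, R (1, b) v), e b = (F ⟨b, hb⟩).2 := fun b hb =>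
    Equiv.extendSubtype_apply_of_mem (Equiv.ofInjective _ hinj) b hb
  refine ⟨wreathMap (fun b h => some (h * if hb : ∃ v, R (1, b) v then (F ⟨b, hb⟩).1 else 1))
    (fun b => some (e b)), ⟨_, ⟨e, rfl⟩, _, fun b _ _ => ⟨_, rfl⟩, rfl⟩, ?_⟩
  rintro ⟨g, b⟩ v h
  have h₁ := equiv g⁻¹ _ _ h
  simp only [lmul_mk, inv_mul_cancel] at h₁
  have hb : ∃ v, R (1, b) v := ⟨_, h₁⟩
  have h₂ := func _ _ _ h₁ (hF ⟨b, hb⟩)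
  simp [wreathMap, he b hb, hb, ← h₂, lmul]

/-! ### Complete flows -/

/-- Completeness of a flow says that a letter which is defined at a state over `q` is defined at
`q`. -/
theorem isCompleteFlow_of {G B : Type*} {σ : X → PT (G × B)} {δ : X → PT Q}
    {f : Q → SetPartition (G × B)} (covers : ∀ z, ∃ q, z ∈ (f q).carrier)
    (maps : ∀ q x, ∀ y ∈ (f q).carrier, ∀ z, σ x y = some z →
      ∃ q', δ x q = some q' ∧ z ∈ (f q').carrier)
    (injective : ∀ q x q', δ x q = some q' →
      ∀ y ∈ (f q).carrier, ∀ y' ∈ (f q).carrier, ∀ z z', σ x y = some z → σ x y' = some z' →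
        ((f q).rel y y' ↔ (f q').rel z z'))
    (crossSection : ∀ q, (f q).IsCrossSection) : IsCompleteFlow σ δ f where
  isFlow :=
    { covers := covers
      maps := fun q x q' hq y hy z hz => by
        obtain ⟨q'', h, hz'⟩ := maps q x y hy z hz
        rw [hq] at h
        exact Option.some.inj h ▸ hz'
      injective := injective
      crossSection := crossSection }
  isFlow_completion :=
    { covers := fun z => (covers z).imp' some fun _ h => h
      maps := fun o x o' ho y hy z hz => by
        cases o with
        | none => exact hy.elim
        | some q =>
          obtain ⟨q', h, hz'⟩ := maps q x y hy z hz
          have h' : some (δ x q) = some o' := ho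
          rw [h] at h'
          exact Option.some.inj h' ▸ hz'
      injective := fun o x o' ho y hy y' hy' z z' hz hz' => by
        cases o with
        | none => exact hy.elim
        | some q =>
          obtain ⟨q', h, -⟩ := maps q x y hy z hz
          have h' : some (δ x q) = some o' := ho
          rw [h] at h'
          exact Option.some.inj h' ▸ injective q x q' h y hy y' hy' z z' hz hz'
      crossSection := fun o => by
        cases o with
        | none => exact fun _ _ _ h => h.elim
        | some q => exact crossSection q }

theorem IsCompleteFlow.exists_eq_some {G B : Type*} {σ : X → PT (G × B)} {δ : X → PT Q}
    {f : Q → SetPartition (G × B)} (hf : IsCompleteFlow σ δ f) {q : Q} {x : X} {y z : G × B}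
    (hy : y ∈ (f q).carrier) (hz : σ x y = some z) : ∃ q', δ x q = some q' := by
  cases h : δ x q with
  | some q' => exact ⟨q', rfl⟩
  | none =>
    have hc : completion δ x (some q) = some none := by simp [completion, h]
    exact (hf.isFlow_completion.maps (some q) x none hc y hy z hz).elim

/-! ### From flows to exact divisions -/

/-- The classes of an invariant cross-section have representatives that are permuted by `G`. -/
theorem SetPartition.exists_equivariant_transversal {p : SetPartition (G × B)}
    (hinv : p.IsInvariant) (hcs : p.IsCrossSection) :
    ∃ α : G × B → G × B, (∀ y ∈ p.carrier, p.rel y (α y)) ∧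
      (∀ y y', p.rel y y' → α y = α y') ∧ ∀ k, ∀ y ∈ p.carrier, α (lmul k y) = lmul k (α y) := by
  classical
  -- `N b b'` says that the classes of `(1, b)` and `(1, b')` are in the same `G`-orbit; the choice
  -- of `β b` depends only on the predicate `N b`, so it is constant on these orbits.
  let N : B → B → Prop := fun b b' => ∃ g, p.rel (1, b) (g, b')
  have hN : ∀ y : G × B, y ∈ p.carrier → N y.2 y.2 := fun y hy => by
    refine ⟨1, p.refl _ ?_⟩
    have := (hinv.mem_iff y.1⁻¹ y).2 hy
    simpa [lmul] using this
  let β : B → B := fun b => if h : ∃ b', N b b' then h.choose else b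
  have hβ : ∀ y : G × B, y ∈ p.carrier → ∃ g, p.rel y (g, β y.2) := fun y hy => by
    have hex : ∃ b', N y.2 b' := ⟨_, hN y hy⟩
    have : N y.2 (β y.2) := by
      simp only [β, dif_pos hex]
      exact hex.choose_spec
    obtain ⟨g, hg⟩ := this
    refine ⟨y.1 * g, ?_⟩
    have := (hinv.rel_iff y.1 _ _).2 hg
    simpa using this
  have hβ_eq : ∀ y y' : G × B, p.rel y y' → β y.2 = β y'.2 := fun y y' h => by
    have hNN : ∀ y y' : G × B, p.rel y y' → ∀ b, N y.2 b → N y'.2 b := by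
      rintro ⟨g, b⟩ ⟨g', b'⟩ h c ⟨u, hu⟩
      have h₁ : p.rel (g, b) (g * u, c) := by simpa using (hinv.rel_iff g _ _).2 hu
      have h₂ := (hinv.rel_iff g'⁻¹ _ _).2 (p.trans _ _ _ (p.symm _ _ h) h₁)
      exact ⟨g'⁻¹ * (g * u), by simpa using h₂⟩
    have : N y.2 = N y'.2 :=
      funext fun b => propext ⟨hNN _ _ h b, hNN _ _ (p.symm _ _ h) b⟩
    have hex : ∃ b, N y'.2 b := ⟨_, hN y' (p.mem_of_rel _ _ h).2⟩
    simp only [β, this, dif_pos hex]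
  have huniq : ∀ y g g' b, p.rel y (g, b) → p.rel y (g', b) → g = g' := fun y g g' b h h' =>
    hcs _ _ _ (p.trans _ _ _ (p.symm _ _ h) h')
  let α : G × B → G × B := fun y => if h : ∃ g, p.rel y (g, β y.2) then (h.choose, β y.2) else y
  have hα : ∀ y ∈ p.carrier, p.rel y (α y) ∧ (α y).2 = β y.2 := fun y hy => by
    have h := hβ y hy
    simp only [α, dif_pos h]
    exact ⟨h.choose_spec, trivial⟩
  have hα_eq : ∀ y ∈ p.carrier, ∀ z, p.rel y z → z.2 = β y.2 → α y = z := by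
    rintro y hy ⟨g, b⟩ hz rfl
    obtain ⟨h₁, h₂⟩ := hα y hy
    refine Prod.ext (huniq y _ _ (β y.2) ?_ hz) h₂
    rw [← h₂]
    exact h₁
  refine ⟨α, fun y hy => (hα y hy).1, fun y y' h => ?_, fun k y hy => ?_⟩
  · obtain ⟨hy, hy'⟩ := p.mem_of_rel _ _ h
    refine hα_eq y hy _ (p.trans _ _ _ h (hα y' hy').1) ?_
    rw [(hα y' hy').2, hβ_eq y y' h]
  · exact hα_eq _ ((hinv.mem_iff k y).2 hy) _ ((hinv.rel_iff k _ _).2 (hα y hy).1) (hα y hy).2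

theorem CoversExactly.mul {P R : Type*} {φ : R → Option P} {w w' : PT R} {s s' : PT P}
    (h : CoversExactly φ w s) (h' : CoversExactly φ w' s') :
    CoversExactly φ (w * w') (s * s') := by
  intro r p hr
  have h₁ := h r p hr
  rw [PT.mul_apply, PT.mul_apply]
  cases hw : w r with
  | none =>
    cases hs : s p with
    | none => rfl
    | some p' => simp [hw, hs] at h₁
  | some r' =>
    cases hs : s p with
    | none => simp [hw, hs] at h₁
    | some p' =>
      simp only [hw, hs, Option.map_some, Option.some.injEq] at h₁
      exact h' r' p' h₁

theorem CoversExactly.covers {P R : Type*} {φ : R → Option P} {w : PT R} {s : PT P}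
    (h : CoversExactly φ w s) : Covers φ w s := by
  intro r p p' hr hp
  have h₁ := h r p hr
  rw [hp] at h₁
  exact Option.map_eq_some_iff.1 h₁

theorem mem_directProd_of_mem_liftsOver {S : Subsemigroup (PT (G × B))}
    (gm : GroupMappingTS S A) {T : Subsemigroup (PT Q)} {t : PT Q} (ht : t ∈ T)
    {s : PT (G × B)} (hs : s ∈ S) {K : Subsemigroup (PT (G × B))} {w : PT (((G × B) × Q) × B)}
    (hw : w ∈ liftsOver K t (rlmMap s)) : w ∈ directProd (wreath K T) gm.RLM := by
  obtain ⟨ρ, hρ, rfl⟩ := hw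
  exact ⟨_, ⟨t, ht, ρ, hρ, rfl⟩, _, ⟨s, hs, rfl⟩, rfl⟩

/-- Products of exact covers are exact covers, so it is enough to cover the generators. -/
theorem isExactDivision_of_generators {P R : Type*} {φ : R → Option P} {σ : X → PT P}
    {W : Subsemigroup (PT R)} (surj : ∀ p, ∃ r, φ r = some p)
    (h : ∀ x, ∃ w ∈ W, CoversExactly φ w (σ x)) :
    IsExactDivision φ (Subsemigroup.closure (Set.range σ)) W where
  surjective := surj
  covers := fun s hs => by
    induction hs using Subsemigroup.closure_induction with
    | mem s hs =>
      obtain ⟨x, rfl⟩ := hs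
      exact h x
    | mul s s' _ _ ih ih' =>
      obtain ⟨w, hw, hc⟩ := ih
      obtain ⟨w', hw', hc'⟩ := ih'
      exact ⟨w * w', W.mul_mem hw hw', hc.mul hc'⟩

theorem exists_exact_covers_of_isRhodesFlow [Finite B] {S : Subsemigroup (PT (G × B))}
    (gm : GroupMappingTS S A) {σ : X → PT (G × B)} (hσ : ∀ x, σ x ∈ S) {τ : X → PT Q}
    {Φ : Q → SetPartition (G × B)} (hΦ : IsRhodesFlow σ τ Φ) :
    ∃ φ : ((G × B) × Q) × B → Option (G × B), (∀ y, ∃ r, φ r = some y) ∧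
      ∀ x, ∃ w ∈ liftsOver (gWrSym G B) (τ x) (rlmMap (σ x)), CoversExactly φ w (σ x) := by
  classical
  have hflow := hΦ.isCompleteFlow.isFlow
  choose α hα hα_eq hα_lmul using fun q =>
    (Φ q).exists_equivariant_transversal (hΦ.invariant q) (hflow.crossSection q)
  have hα_rel : ∀ q, ∀ y ∈ (Φ q).carrier, ∀ y' ∈ (Φ q).carrier, α q y = α q y' →
      (Φ q).rel y y' := fun q y hy y' hy' h =>
    (Φ q).trans _ _ _ (hα q y hy) (h ▸ (Φ q).symm _ _ (hα q y' hy'))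
  let D : ((G × B) × Q) × B → G → Prop := fun r g =>
    (g, r.2) ∈ (Φ r.1.2).carrier ∧ α r.1.2 (g, r.2) = r.1.1
  let φ : ((G × B) × Q) × B → Option (G × B) := fun r =>
    if h : ∃ g, D r g then some (h.choose, r.2) else none
  have hφ : ∀ p q b y, φ ((p, q), b) = some y ↔ y ∈ (Φ q).carrier ∧ α q y = p ∧ y.2 = b := by
    intro p q b y
    constructor
    · intro h
      by_cases hex : ∃ g, D ((p, q), b) g
      · simp only [φ, dif_pos hex, Option.some.injEq] at h
        subst h
        exact ⟨hex.choose_spec.1, hex.choose_spec.2, rfl⟩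
      · simp only [φ, dif_neg hex] at h
        cases h
    · obtain ⟨g, b'⟩ := y
      rintro ⟨hy, hp, rfl⟩
      have hex : ∃ g', D ((p, q), b') g' := ⟨g, hy, hp⟩
      simp only [φ, dif_pos hex, Option.some.injEq, Prod.mk.injEq, and_true]
      have hs := hex.choose_spec
      exact hflow.crossSection q _ _ _ (hα_rel q _ hs.1 _ hy (hs.2.trans hp.symm))
  refine ⟨φ, fun y => ?_, fun x => ?_⟩
  · obtain ⟨q, hq⟩ := hflow.covers y
    exact ⟨((α q y, q), y.2), (hφ _ _ _ _).2 ⟨hq, rfl, rfl⟩⟩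
  -- the action of the letter on classes, transported to representatives
  have hρ : ∀ q, ∃ w : PT (G × B), ∀ q', τ x q = some q' → w ∈ gWrSym G B ∧
      ∀ y ∈ (Φ q).carrier, ∀ z, σ x y = some z → w (α q y) = some (α q' z) := by
    intro q
    cases hq : τ x q with
    | none => exact ⟨fun _ => none, fun q' h => by cases h⟩
    | some q' =>
      let R : G × B → G × B → Prop := fun u v =>
        ∃ y ∈ (Φ q).carrier, ∃ z, σ x y = some z ∧ α q y = u ∧ α q' z = v
      have hequiv : ∀ k u v, R u v → R (lmul k u) (lmul k v) := by
        rintro k _ _ ⟨y, hy, z, hz, rfl, rfl⟩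
        exact ⟨lmul k y, ((hΦ.invariant q).mem_iff k y).2 hy, lmul k z,
          gm.apply_lmul (hσ x) k hz, hα_lmul q k y hy,
          hα_lmul q' k z (hflow.maps q x q' hq y hy z hz)⟩
      have hfunc : ∀ u v v', R u v → R u v' → v = v' := by
        rintro _ _ _ ⟨y, hy, z, hz, rfl, rfl⟩ ⟨y', hy', z', hz', hu, rfl⟩
        exact hα_eq _ _ _ ((hflow.injective q x q' hq y hy y' hy' z z' hz hz').1
          (hα_rel q _ hy _ hy' hu.symm))
      have hinj : ∀ u u' v, R u v → R u' v → u = u' := by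
        rintro _ _ _ ⟨y, hy, z, hz, rfl, rfl⟩ ⟨y', hy', z', hz', rfl, hv⟩
        exact hα_eq _ _ _ ((hflow.injective q x q' hq y hy y' hy' z z' hz hz').2
          (hα_rel q' _ (hflow.maps q x q' hq y hy z hz) _
            (hflow.maps q x q' hq y' hy' z' hz') hv.symm))
      obtain ⟨w, hw, hR⟩ := exists_mem_gWrSym_of_equivariant R hequiv hfunc hinj
      refine ⟨w, fun q'' h => ?_⟩
      obtain rfl := Option.some.inj h
      exact ⟨hw, fun y hy z hz => hR _ _ ⟨y, hy, z, hz, rfl, rfl⟩⟩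
  choose ρ hρ using hρ
  refine ⟨_, ⟨ρ, fun q q' h => (hρ q q' h).1, rfl⟩, ?_⟩
  rintro ⟨⟨p, q⟩, b⟩ y hr
  obtain ⟨hy, rfl, rfl⟩ := (hφ _ _ _ _).1 hr
  cases hz : σ x y with
  | none =>
    have hrlm : rlmMap (σ x) y.2 = none := by
      cases h : rlmMap (σ x) y.2 with
      | none => rfl
      | some b =>
        obtain ⟨z, hz'⟩ := gm.exists_apply_of_rlmMap (hσ x) h
        rw [hz] at hz'
        cases hz'
    simp [prodMap, hrlm]
  | some z =>
    obtain ⟨q', hq⟩ := hΦ.isCompleteFlow.exists_eq_some hy hz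
    have hw := (hρ q q' hq).2 y hy z hz
    have : φ ((α q' z, q'), z.2) = some z :=
      (hφ _ _ _ _).2 ⟨hflow.maps q x q' hq y hy z hz, rfl, rfl⟩
    simp [prodMap, wreathMap, hq, hw, gm.rlmMap_apply (hσ x) hz, this]

/-! ### Label sets of a division -/

/-- The states `p` of `G ≀ Sym(B)` that `φ`, at `q` and at the second coordinate of `y`, sends to
`y`. -/
def fiber (φ : ((G × B) × Q) × B → Option (G × B)) (v : Q × (G × B)) : Set (G × B) :=
  {p | φ ((p, v.1), v.2.2) = some v.2}

/-- The edges of the graph on `Q × (G × B)`: a letter acts on both components. -/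
def Step (σ : X → PT (G × B)) (τ : X → PT Q) (v v' : Q × (G × B)) : Prop :=
  ∃ x, τ x v.1 = some v'.1 ∧ σ x v.2 = some v'.2

theorem Step.lmul {S : Subsemigroup (PT (G × B))} (gm : GroupMappingTS S A)
    {σ : X → PT (G × B)} (hσ : ∀ x, σ x ∈ S) {τ : X → PT Q} (k : G) {v v' : Q × (G × B)}
    (h : Step σ τ v v') : Step σ τ (v.1, lmul k v.2) (v'.1, FlowTheory.lmul k v'.2) := by
  obtain ⟨x, h₁, h₂⟩ := h
  exact ⟨x, h₁, gm.apply_lmul (hσ x) k h₂⟩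

section Division

variable {S : Subsemigroup (PT (G × B))} {σ : X → PT (G × B)} {τ : X → PT Q}
  {φ : ((G × B) × Q) × B → Option (G × B)}

theorem exists_eq_some_of_covers
    (hφ : ∀ x, ∃ w ∈ liftsOver (gWrSym G B) (τ x) (rlmMap (σ x)), Covers φ w (σ x))
    {p : G × B} {q : Q} {b : B} {y z : G × B} (hr : φ ((p, q), b) = some y) {x : X}
    (hz : σ x y = some z) :
    ∃ p' q' b', τ x q = some q' ∧ rlmMap (σ x) b = some b' ∧ φ ((p', q'), b') = some z := by
  obtain ⟨_, ⟨ρ, hρ, rfl⟩, hc⟩ := hφ x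
  obtain ⟨r', hr', hφr'⟩ := hc _ _ _ hr hz
  obtain ⟨v, hv, hvb⟩ := Option.bind_eq_some_iff.1 hr'
  obtain ⟨b', hb, rfl⟩ := Option.map_eq_some_iff.1 hvb
  obtain ⟨q', hq, hqp⟩ := Option.bind_eq_some_iff.1 hv
  obtain ⟨p', -, rfl⟩ := Option.map_eq_some_iff.1 hqp
  exact ⟨p', q', b', hq, hb, hφr'⟩

/-- A letter acts on the labels over a state `q` by a map which is injective and does not depend on
the element of `G × B` that is labelled. -/
theorem exists_injective_mapsTo_fiber (gm : GroupMappingTS S A) (hσ : ∀ x, σ x ∈ S)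
    (hφ : ∀ x, ∃ w ∈ liftsOver (gWrSym G B) (τ x) (rlmMap (σ x)), Covers φ w (σ x))
    {x : X} {q q' : Q} (hq : τ x q = some q') :
    ∃ f : G × B → G × B, Function.Injective f ∧
      ∀ y z, σ x y = some z → Set.MapsTo f (fiber φ (q, y)) (fiber φ (q', z)) := by
  obtain ⟨_, ⟨ρ, hρ, rfl⟩, hc⟩ := hφ x
  obtain ⟨f, hf, hρf⟩ := exists_injective_of_mem_gWrSym (hρ q q' hq)
  refine ⟨f, hf, fun y z hz p hp => ?_⟩
  obtain ⟨r', hr', hφr'⟩ := hc _ _ _ hp hz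
  have hb := gm.rlmMap_apply (hσ x) hz
  simp only [prodMap, wreathMap, hq, hρf, hb, Option.bind_some, Option.map_some,
    Option.some.injEq] at hr'
  subst hr'
  exact hφr'

theorem exists_step_of_fiber_nonempty
    (hφ : ∀ x, ∃ w ∈ liftsOver (gWrSym G B) (τ x) (rlmMap (σ x)), Covers φ w (σ x))
    {q : Q} {y z : G × B} (h : (fiber φ (q, y)).Nonempty) {x : X} (hz : σ x y = some z) :
    ∃ q', τ x q = some q' := by
  obtain ⟨p, hp⟩ := h
  obtain ⟨_, q', _, hq, _⟩ := exists_eq_some_of_covers hφ hp hz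
  exact ⟨q', hq⟩

theorem ncard_fiber_le [Finite G] [Finite B] (gm : GroupMappingTS S A) (hσ : ∀ x, σ x ∈ S)
    (hφ : ∀ x, ∃ w ∈ liftsOver (gWrSym G B) (τ x) (rlmMap (σ x)), Covers φ w (σ x))
    {v v' : Q × (G × B)} (h : Relation.ReflTransGen (Step σ τ) v v') :
    (fiber φ v).ncard ≤ (fiber φ v').ncard := by
  induction h with
  | refl => exact le_rfl
  | tail _ h ih =>
    obtain ⟨x, hq, hy⟩ := h
    obtain ⟨f, hf, hm⟩ := exists_injective_mapsTo_fiber gm hσ hφ hq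
    exact ih.trans (Set.ncard_le_ncard_of_injOn f (hm _ _ hy) hf.injOn)

theorem fiber_nonempty_of_reach [Finite G] [Finite B] (gm : GroupMappingTS S A)
    (hσ : ∀ x, σ x ∈ S)
    (hφ : ∀ x, ∃ w ∈ liftsOver (gWrSym G B) (τ x) (rlmMap (σ x)), Covers φ w (σ x))
    {v v' : Q × (G × B)} (h : Relation.ReflTransGen (Step σ τ) v v')
    (hv : (fiber φ v).Nonempty) : (fiber φ v').Nonempty := by
  rw [← Set.ncard_pos] at hv ⊢
  exact hv.trans_le (ncard_fiber_le gm hσ hφ h)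

theorem exists_reach_of_mem_closure [Finite G] [Finite B] (gm : GroupMappingTS S A)
    (hσ : ∀ x, σ x ∈ S)
    (hφ : ∀ x, ∃ w ∈ liftsOver (gWrSym G B) (τ x) (rlmMap (σ x)), Covers φ w (σ x))
    {s : PT (G × B)} (hs : s ∈ Subsemigroup.closure (Set.range σ)) :
    ∀ {q : Q} {y z : G × B}, (fiber φ (q, y)).Nonempty → s y = some z →
      ∃ q', Relation.ReflTransGen (Step σ τ) (q, y) (q', z) := by
  induction hs using Subsemigroup.closure_induction with
  | mem s hs =>
    obtain ⟨x, rfl⟩ := hs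
    intro q y z h hz
    obtain ⟨q', hq⟩ := exists_step_of_fiber_nonempty hφ h hz
    exact ⟨q', .single ⟨x, hq, hz⟩⟩
  | mul s t _ _ ih ih' =>
    intro q y z h hz
    rw [PT.mul_apply] at hz
    obtain ⟨u, hu, hz⟩ := Option.bind_eq_some_iff.1 hz
    obtain ⟨q', h₁⟩ := ih h hu
    obtain ⟨q'', h₂⟩ := ih' (fiber_nonempty_of_reach gm hσ hφ h₁ h) hz
    exact ⟨q'', h₁.trans h₂⟩

/-- Some pair has a label: an element of the 0-minimal ideal moves any state of the division to one
whose two `B`-coordinates agree. -/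
theorem exists_fiber_nonempty (gm : GroupMappingTS S A)
    (hσ : Subsemigroup.closure (Set.range σ) = S)
    (hφ : ∀ x, ∃ w ∈ liftsOver (gWrSym G B) (τ x) (rlmMap (σ x)), Covers φ w (σ x))
    (surj : ∀ y, ∃ r, φ r = some y) : ∃ v, (fiber φ v).Nonempty := by
  have key : ∀ s ∈ Subsemigroup.closure (Set.range σ), ∀ p q b y z, φ ((p, q), b) = some y →
      s y = some z → ∃ p' q' b', rlmMap s b = some b' ∧ φ ((p', q'), b') = some z := by
    intro s hs
    induction hs using Subsemigroup.closure_induction with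
    | mem s hs =>
      obtain ⟨x, rfl⟩ := hs
      intro p q b y z hr hz
      obtain ⟨p', q', b', _, hb, h⟩ := exists_eq_some_of_covers hφ hr hz
      exact ⟨p', q', b', hb, h⟩
    | mul s t hs ht ih ih' =>
      intro p q b y z hr hz
      rw [PT.mul_apply] at hz
      obtain ⟨u, hu, hz⟩ := Option.bind_eq_some_iff.1 hz
      obtain ⟨p', q', b', hb, h⟩ := ih _ _ _ _ _ hr hu
      obtain ⟨p'', q'', b'', hb', h'⟩ := ih' _ _ _ _ _ h hz
      refine ⟨p'', q'', b'', ?_, h'⟩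
      rw [gm.rlmMap_mul ⟨s, hσ ▸ hs⟩ ⟨t, hσ ▸ ht⟩, PT.mul_apply]
      simp [hb, hb']
  obtain ⟨b₀, -⟩ := gm.col_ne_zero gm.a₀
  obtain ⟨⟨⟨p, q⟩, b⟩, hr⟩ := surj (1, b₀)
  obtain ⟨s, hs, z, hz, hconst⟩ := gm.exists_collapse (1, b₀)
  obtain ⟨p', q', b', hb, h⟩ := key s (hσ ▸ hs) _ _ _ _ _ hr hz
  obtain rfl := hconst _ _ hb
  exact ⟨(q', z), p', h⟩

end Division

/-- From every vertex of a finite directed graph one reaches a terminal strong component. -/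
theorem exists_reach_terminal {V : Type*} [Finite V] (r : V → V → Prop) (v : V) :
    ∃ m, Relation.ReflTransGen r v m ∧
      ∀ u, Relation.ReflTransGen r m u → Relation.ReflTransGen r u m := by
  obtain ⟨m, hm, hmin⟩ := Set.exists_min_image {m | Relation.ReflTransGen r v m}
    (fun m => {u | Relation.ReflTransGen r m u}.ncard) (Set.toFinite _) ⟨v, .refl⟩
  refine ⟨m, hm, fun u hu => ?_⟩
  have hsub : {w | Relation.ReflTransGen r u w} ⊆ {w | Relation.ReflTransGen r m w} :=
    fun w hw => hu.trans hw
  have := Set.eq_of_subset_of_ncard_le hsub (hmin u (hm.trans hu))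
  have hmem : m ∈ {w | Relation.ReflTransGen r m w} := .refl
  rw [← this] at hmem
  exact hmem

/-! ### From divisions to flows -/

/-- The label sets within `M` of the left translates of the state `y` over `q`. -/
def translateFibers (φ : ((G × B) × Q) × B → Option (G × B)) (M : Set (Q × (G × B))) (q : Q)
    (y : G × B) : G → Set (G × B) :=
  fun k => {p | (q, lmul k y) ∈ M ∧ p ∈ fiber φ (q, lmul k y)}

/-- The states over `q` are those with a left translate in `M`; two of them are equivalent when
corresponding left translates have the same label sets within `M`. -/
def fiberPartition (φ : ((G × B) × Q) × B → Option (G × B)) (M : Set (Q × (G × B))) (q : Q) :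
    SetPartition (G × B) where
  carrier := {y | ∃ k : G, (q, lmul k y) ∈ M}
  rel y y' := (∃ k : G, (q, lmul k y) ∈ M) ∧ (∃ k : G, (q, lmul k y') ∈ M) ∧
    translateFibers φ M q y = translateFibers φ M q y'
  mem_of_rel _ _ h := ⟨h.1, h.2.1⟩
  refl _ h := ⟨h, h, rfl⟩
  symm _ _ h := ⟨h.2.1, h.1, h.2.2.symm⟩
  trans _ _ _ h h' := ⟨h.1, h'.2.1, h.2.2.trans h'.2.2⟩

theorem translateFibers_of_mem {φ : ((G × B) × Q) × B → Option (G × B)} {M : Set (Q × (G × B))}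
    {q : Q} {y : G × B} {k : G} (h : (q, lmul k y) ∈ M) :
    translateFibers φ M q y k = fiber φ (q, lmul k y) :=
  Set.ext fun _ => and_iff_right h

theorem translateFibers_lmul (φ : ((G × B) × Q) × B → Option (G × B)) (M : Set (Q × (G × B)))
    (q : Q) (k : G) (y : G × B) :
    translateFibers φ M q (lmul k y) = fun l => translateFibers φ M q y (l * k) := by
  funext l
  simp [translateFibers]

theorem fiberPartition_isInvariant (φ : ((G × B) × Q) × B → Option (G × B))
    (M : Set (Q × (G × B))) (q : Q) : (fiberPartition φ M q).IsInvariant := by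
  have hmem : ∀ (k : G) (y : G × B),
      (∃ l : G, (q, lmul l (lmul k y)) ∈ M) ↔ ∃ l : G, (q, lmul l y) ∈ M := by
    intro k y
    refine ⟨fun ⟨l, h⟩ => ⟨l * k, by simpa using h⟩, fun ⟨l, h⟩ => ⟨l * k⁻¹, by simpa using h⟩⟩
  refine ⟨fun k g b => hmem k (g, b), fun k g b g' b' => ?_⟩
  refine and_congr (hmem k (g, b)) (and_congr (hmem k (g', b')) ?_)
  rw [← lmul_mk, ← lmul_mk, translateFibers_lmul, translateFibers_lmul]
  constructor
  · intro h
    funext l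
    simpa using congrFun h (l * k⁻¹)
  · intro h
    rw [h]

theorem fiberPartition_isCrossSection {φ : ((G × B) × Q) × B → Option (G × B)}
    {M : Set (Q × (G × B))} (hM : ∀ v ∈ M, (fiber φ v).Nonempty) (q : Q) :
    (fiberPartition φ M q).IsCrossSection := by
  rintro g h b ⟨⟨k, hk⟩, -, heq⟩
  obtain ⟨p, hp⟩ := hM _ hk
  have h₁ : p ∈ translateFibers φ M q (g, b) k := ⟨hk, hp⟩
  rw [heq] at h₁
  have h₂ := h₁.2
  simp only [fiber, lmul_mk, Set.mem_ofPred_eq] at hp h₂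
  rw [hp] at h₂
  simpa using h₂

theorem exists_isRhodesFlow_of_covers [Finite G] [Finite B] [Finite Q]
    {S : Subsemigroup (PT (G × B))} (gm : GroupMappingTS S A) {σ : X → PT (G × B)}
    (hσ : Subsemigroup.closure (Set.range σ) = S) {τ : X → PT Q}
    {φ : ((G × B) × Q) × B → Option (G × B)} (surj : ∀ y, ∃ r, φ r = some y)
    (hφ : ∀ x, ∃ w ∈ liftsOver (gWrSym G B) (τ x) (rlmMap (σ x)), Covers φ w (σ x)) :
    ∃ Φ : Q → SetPartition (G × B), IsRhodesFlow σ τ Φ := by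
  have hσS : ∀ x, σ x ∈ S := fun x => hσ ▸ Subsemigroup.subset_closure ⟨x, rfl⟩
  obtain ⟨v, hv⟩ := exists_fiber_nonempty gm hσ hφ surj
  obtain ⟨m, hvm, hm⟩ := exists_reach_terminal (Step σ τ) v
  have hmne := fiber_nonempty_of_reach gm hσS hφ hvm hv
  let M : Set (Q × (G × B)) := {u | Relation.ReflTransGen (Step σ τ) m u}
  have hMne : ∀ u ∈ M, (fiber φ u).Nonempty := fun u hu =>
    fiber_nonempty_of_reach gm hσS hφ hu hmne
  have hMstep : ∀ u ∈ M, ∀ u', Step σ τ u u' → u' ∈ M := fun u hu u' h => hu.tail h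
  -- the translate of `M` that contains `(q, y)` is strongly connected, and it meets `M` in `(q', z)`
  have hback : ∀ (q : Q) (y : G × B) (k : G), (q, lmul k y) ∈ M → ∀ q' z,
      Step σ τ (q, y) (q', z) → (q', z) ∈ M → (q, y) ∈ M := by
    intro q y k hk q' z hs hz
    have h₁ : (q', lmul k z) ∈ M := hMstep _ hk _ (hs.lmul gm hσS k)
    have h₂ : Relation.ReflTransGen (Step σ τ) (q', lmul k z) (q, lmul k y) := (hm _ h₁).trans hk
    have h₃ := h₂.lift (fun u => (u.1, lmul k⁻¹ u.2)) fun _ _ h => h.lmul gm hσS k⁻¹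
    have h₄ : Relation.ReflTransGen (Step σ τ) (q', z) (q, y) := by
      simpa [Function.onFun] using h₃
    exact Relation.ReflTransGen.trans hz h₄
  have himage : ∀ x q q', τ x q = some q' → ∃ f : G × B → G × B, Function.Injective f ∧
      ∀ y ∈ (fiberPartition φ M q).carrier, ∀ z, σ x y = some z →
        translateFibers φ M q' z = fun k => f '' translateFibers φ M q y k := by
    intro x q q' hq
    obtain ⟨f, hf, hmaps⟩ := exists_injective_mapsTo_fiber gm hσS hφ hq
    refine ⟨f, hf, fun y ⟨l, hl⟩ z hz => funext fun k => ?_⟩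
    have hzk := gm.apply_lmul (hσS x) k hz
    have hs : Step σ τ (q, lmul k y) (q', lmul k z) := ⟨x, hq, hzk⟩
    by_cases hk : (q, lmul k y) ∈ M
    · have hk' := hMstep _ hk _ hs
      have heq : f '' fiber φ (q, lmul k y) = fiber φ (q', lmul k z) := by
        refine Set.eq_of_subset_of_ncard_le (hmaps _ _ hzk).image_subset ?_
        rw [Set.ncard_image_of_injective _ hf]
        exact ncard_fiber_le gm hσS hφ ((hm _ hk').trans hk)
      rw [translateFibers_of_mem hk, translateFibers_of_mem hk', heq]
    · have hk' : (q', lmul k z) ∉ M := fun h =>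
        hk (hback _ _ (l * k⁻¹) (by simpa using hl) _ _ hs h)
      simp [translateFibers, hk, hk']
  refine ⟨fiberPartition φ M, isCompleteFlow_of ?_ ?_ ?_ (fiberPartition_isCrossSection hMne),
    fiberPartition_isInvariant φ M⟩
  · intro z
    obtain ⟨s, hs, hsz⟩ := gm.exists_apply_eq m.2 z
    obtain ⟨q, hq⟩ := exists_reach_of_mem_closure gm hσS hφ (hσ ▸ hs) hmne hsz
    exact ⟨q, 1, by rw [one_lmul]; exact hq⟩
  · rintro q x y ⟨k, hk⟩ z hz
    have hzk := gm.apply_lmul (hσS x) k hz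
    obtain ⟨q', hq⟩ := exists_step_of_fiber_nonempty hφ (hMne _ hk) hzk
    exact ⟨q', hq, k, hMstep _ hk _ ⟨x, hq, hzk⟩⟩
  · rintro q x q' hq y hy y' hy' z z' hz hz'
    obtain ⟨f, hf, himg⟩ := himage x q q' hq
    have hmem : ∀ u ∈ (fiberPartition φ M q).carrier, ∀ t, σ x u = some t →
        ∃ k : G, (q', lmul k t) ∈ M := fun u ⟨k, hk⟩ t ht =>
      ⟨k, hMstep _ hk _ ⟨x, hq, gm.apply_lmul (hσS x) k ht⟩⟩
    have h₁ : translateFibers φ M q y = translateFibers φ M q y' ↔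
        translateFibers φ M q' z = translateFibers φ M q' z' := by
      rw [himg y hy z hz, himg y' hy' z' hz']
      refine ⟨fun h => by rw [h], fun h => funext fun k => ?_⟩
      exact hf.image_injective (congrFun h k)
    exact ⟨fun h => ⟨hmem y hy z hz, hmem y' hy' z' hz', h₁.1 h.2.2⟩,
      fun h => ⟨hy, hy', h₁.2 h.2.2⟩⟩

end FlowTheory

theorem mainTheorem2 {G B Q X A : Type*} [Group G] [Finite G] [Finite B] [Finite Q] [Finite A]
    (S : Subsemigroup (FlowTheory.PT (G × B))) (gm : FlowTheory.GroupMappingTS S A)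
    (T : Subsemigroup (FlowTheory.PT Q))
    (σ : X → FlowTheory.PT (G × B)) (hσ : Subsemigroup.closure (Set.range σ) = S)
    (τ : X → FlowTheory.PT Q) (hτ : Subsemigroup.closure (Set.range τ) = T) :
    List.TFAE [
      ∃ Φ : Q → FlowTheory.SetPartition (G × B), FlowTheory.IsRhodesFlow σ τ Φ,
      ∃ φ : ((G × B) × Q) × B → Option (G × B),
        FlowTheory.IsDivision φ S
          (FlowTheory.directProd (FlowTheory.wreath (FlowTheory.gWrSym G B) T) gm.RLM) ∧
        ∀ x, ∃ w ∈ FlowTheory.liftsOver (FlowTheory.gWrSym G B) (τ x) (FlowTheory.rlmMap (σ x)),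
          FlowTheory.Covers φ w (σ x),
      ∃ φ : ((G × B) × Q) × B → Option (G × B),
        FlowTheory.IsExactDivision φ S
          (FlowTheory.directProd (FlowTheory.wreath (FlowTheory.gWrSym G B) T) gm.RLM) ∧
        ∀ x, ∃ w ∈ FlowTheory.liftsOver (FlowTheory.gWrSym G B) (τ x) (FlowTheory.rlmMap (σ x)),
          FlowTheory.CoversExactly φ w (σ x)] := by

  have hσS : ∀ x, σ x ∈ S := fun x => hσ ▸ Subsemigroup.subset_closure ⟨x, rfl⟩
  have hτT : ∀ x, τ x ∈ T := fun x => hτ ▸ Subsemigroup.subset_closure ⟨x, rfl⟩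
  tfae_have 1 → 3 := by
    rintro ⟨Φ, hΦ⟩
    obtain ⟨φ, hsurj, hc⟩ := FlowTheory.exists_exact_covers_of_isRhodesFlow gm hσS hΦ
    refine ⟨φ, ?_, hc⟩
    have := FlowTheory.isExactDivision_of_generators
      (W := FlowTheory.directProd (FlowTheory.wreath (FlowTheory.gWrSym G B) T) gm.RLM)
      hsurj fun x => (hc x).imp fun w hw =>
        ⟨FlowTheory.mem_directProd_of_mem_liftsOver gm (hτT x) (hσS x) hw.1, hw.2⟩
    rwa [hσ] at this
  tfae_have 3 → 2 := by
    rintro ⟨φ, hφ, hc⟩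
    exact ⟨φ, ⟨hφ.surjective, fun s hs => (hφ.covers s hs).imp fun w hw => ⟨hw.1, hw.2.covers⟩⟩,
      fun x => (hc x).imp fun w hw => ⟨hw.1, hw.2.covers⟩⟩
  tfae_have 2 → 1 := by
    rintro ⟨φ, hφ, hc⟩
    exact FlowTheory.exists_isRhodesFlow_of_covers gm hσ hφ.surjective hc
  tfae_finish
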